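/- Let $\mathfrak g$ be a finite-dimensional semisimple complex Lie algebra and let $\mathfrak l\subseteq\mathfrak g$ be a reductive subalgebra. Let $\mathfrak h$ be a Cartan subalgebra of $\mathfrak g$ such that $\mathfrak h_{\mathfrak l}:=\mathfrak h\cap\mathfrak l$ is a Cartan subalgebra of $\mathfrak l$, and let $\mathfrak p$ be a parabolic subalgebra of $\mathfrak g$ such that $\mathfrak h\subseteq\mathfrak p$ and $\mathfrak p\cap\mathfrak l$ is a parabolic subalgebra of $\mathfrak l$. Let $M$ be a (possibly infinite-dimensional) $\mathfrak g$-module on which $\mathfrak p$ acts locally finitely, i.e. every vector of $M$ lies in a finite-dimensional $\mathfrak p$-submodule. Let $\mathrm{supp}_{\mathfrak h}M$ be the set of $\eta\in\mathfrak h^*$ for which there is a nonzero $m\in M$ with $x\cdot m=\eta(x)m$ for all $x\in\mathfrak h$. Call $\xi\in\mathfrak h_{\mathfrak l}^*$ integral relative to $\mathfrak l$ if $\xi(\alpha^\vee)\in\mathbb Z$ for every root $\alpha$ of $(\mathfrak l,\mathfrak h_{\mathfrak l})$, where the coroot $\alpha^\vee$ is the element of $[\mathfrak l^{\alpha},\mathfrak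 l^{-\alpha}]\subseteq\mathfrak h_{\mathfrak l}$ with $\alpha(\alpha^\vee)=2$. Assume that for every $\eta\in\mathrm{supp}_{\mathfrak h}M$ the restriction $\eta|_{\mathfrak h_{\mathfrak l}}$ is not integral relative to $\mathfrak l$. Then for every nonzero subquotient $M_1$ of the $\mathfrak g$-module $M$ one has $\mathfrak l\nsubseteq\mathfrak g[M_1]$, where the Fernando–Kac subalgebra $\mathfrak g[M_1]$ is the set of all $x\in\mathfrak g$ acting locally finitely on $M_1$, i.e. such that for every $m\in M_1$ the vectors $m, x m, x^2 m,\dots$ span a finite-dimensional space. -/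

import Mathlib

/-- A Borel subalgebra of a Lie algebra: a maximal solvable subalgebra. -/
def LieSubalgebra.IsBorel {L : Type*} [LieRing L] [LieAlgebra ℂ L]
    (b : LieSubalgebra ℂ L) : Prop :=
  Maximal (fun c : LieSubalgebra ℂ L => LieAlgebra.IsSolvable c) b

/-- A parabolic subalgebra: a subalgebra containing a Borel subalgebra. -/
def LieSubalgebra.IsParabolic {L : Type*} [LieRing L] [LieAlgebra ℂ L]
    (p : LieSubalgebra ℂ L) : Prop :=
  ∃ b : LieSubalgebra ℂ L, b.IsBorel ∧ b ≤ p

/-- The Lie algebra `L` acts locally finitely on `M`: every vector generates a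
finite-dimensional `L`-submodule. -/
def LieModule.ActsLocallyFinitely (L M : Type*) [LieRing L] [LieAlgebra ℂ L]
    [AddCommGroup M] [Module ℂ M] [LieRingModule L M] [LieModule ℂ L M] : Prop :=
  ∀ m : M, FiniteDimensional ℂ (LieSubmodule.lieSpan ℂ L {m})

/-- The support of `M`: the linear forms `η` on `L` such that the space
`{m | ∀ x, ⁅x, m⁆ = η x • m}` is nonzero. -/
def LieModule.support (L M : Type*) [LieRing L] [LieAlgebra ℂ L]
    [AddCommGroup M] [Module ℂ M] [LieRingModule L M] [LieModule ℂ L M] :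
    Set (Module.Dual ℂ L) :=
  {η | LieModule.weightSpace M (η : L → ℂ) ≠ ⊥}

/-- The coroots of a reductive Lie algebra with respect to a Cartan subalgebra `H`: the coroot of
a root `α` is the element `t` of `[L_α, L_{-α}] ⊆ H` with `α t = 2`. -/
def LieAlgebra.IsCoroot {L : Type*} [LieRing L] [LieAlgebra ℂ L] (H : LieSubalgebra ℂ L)
    [FiniteDimensional ℂ L] [H.IsCartanSubalgebra] (α : LieModule.Weight ℂ H L) (t : H) : Prop :=
  α.IsNonZero ∧ t ∈ LieAlgebra.corootSpace (α : H → ℂ) ∧ α t = 2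

/-- A weight of a Cartan subalgebra `H` of a reductive Lie algebra `L` is integral relative to `L`
if it takes an integral value at every coroot. -/
def LieAlgebra.IsIntegralWeight {L : Type*} [LieRing L] [LieAlgebra ℂ L] (H : LieSubalgebra ℂ L)
    [FiniteDimensional ℂ L] [H.IsCartanSubalgebra] (ξ : Module.Dual ℂ H) : Prop :=
  ∀ (α : LieModule.Weight ℂ H L) (t : H), LieAlgebra.IsCoroot H α t → ∃ n : ℤ, ξ t = n

/-- The intersection `h ∩ l`, regarded as a subalgebra of `l`. -/
abbrev LieSubalgebra.within {g : Type*} [LieRing g] [LieAlgebra ℂ g]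
    (h l : LieSubalgebra ℂ g) : LieSubalgebra ℂ l :=
  h.comap l.incl

/-- The restriction of a linear form on `h` to `h ∩ l`. -/
def LieSubalgebra.restrictDual {g : Type*} [LieRing g] [LieAlgebra ℂ g]
    (h l : LieSubalgebra ℂ g) (η : Module.Dual ℂ h) : Module.Dual ℂ (h.within l) where
  toFun x := η ⟨((x : l) : g), x.2⟩
  map_add' x y := η.map_add ⟨((x : l) : g), x.2⟩ ⟨((y : l) : g), y.2⟩
  map_smul' c x := η.map_smul c ⟨((x : l) : g), x.2⟩

/-- `M₁` is (isomorphic to) a subquotient of `M`: a quotient of a submodule of `M`. -/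
def LieModule.IsSubquotient (g M₁ M : Type*) [LieRing g] [LieAlgebra ℂ g]
    [AddCommGroup M₁] [Module ℂ M₁] [LieRingModule g M₁] [LieModule ℂ g M₁]
    [AddCommGroup M] [Module ℂ M] [LieRingModule g M] [LieModule ℂ g M] : Prop :=
  ∃ (N : LieSubmodule ℂ g M) (f : N →ₗ⁅ℂ,g⁆ M₁), Function.Surjective f

/-- The Fernando–Kac subalgebra `g[N]`, as the set of all `x` in `g` that act locally finitely
on `N`: for every `m`, the vectors `m, x m, x² m, …` span a finite-dimensional space. -/
def LieModule.fernandoKac (g N : Type*) [LieRing g] [LieAlgebra ℂ g]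
    [AddCommGroup N] [Module ℂ N] [LieRingModule g N] [LieModule ℂ g N] : Set g :=
  {x | ∀ m : N, FiniteDimensional ℂ
    (Submodule.span ℂ (Set.range fun k : ℕ => (LieModule.toEnd ℂ g N x ^ k) m))}

/-!
The idea is `sl₂`-theory applied to a single weight vector. Suppose `l` is contained in the
Fernando–Kac subalgebra of the nonzero subquotient `M₁`. As `h ≤ p` acts locally finitely on `M`,
a nonzero vector of `M₁` lifts to a finite-dimensional `h`-module inside `M`, and decomposing this
module into generalized weight spaces gives a weight `η` that is attained by genuine weight vectors
both in `M` and in `M₁` (`LieModuleHom.exists_common_weight`). So `η` belongs to the support of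
`M`, and it remains to see that its restriction to `h ∩ l` is integral.

Let `t` be the coroot of a root `α` of `l`. It belongs to an `sl₂`-triple `(t, e, f)` with `e` and
`f` in `l` (`LieSubalgebra.exists_isSl2Triple_of_isCoroot`). A weight vector `v ∈ M₁` of weight `η`
satisfies `t v = η(t) v`, and `e` and `f` act locally finitely on `M₁`. The vectors `eᵏ v` are
eigenvectors of `t` with distinct eigenvalues, so one of them vanishes, and the last nonzero one is
a primitive vector; the same argument for `f` makes its eigenvalue a natural number. Hence `η(t)`
is an integer (`IsSl2Triple.exists_int_of_locallyFinite`).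

The `sl₂`-triple is found without the structure theory of reductive Lie algebras, using that
`h ∩ l` lies in a Cartan subalgebra of `g`, hence acts semisimply on `g`: some bracket
`⁅e, f⁆ ∈ ⁅l^α, l^{-α}⁆` has `α ⁅e, f⁆ = 2`, and it equals `t` since an element of
`⁅l^α, l^{-α}⁆` killed by `α` is killed by all weights of the `l`-module `g`, so is zero.
-/

open LieModule LieAlgebra

/-! ### Weights and finite-dimensional lifts -/

/-- The image of a finite-dimensional module under a nonzero homomorphism shares a weight with the
module itself, with genuine weight vectors on both sides. -/
theorem LieModuleHom.exists_common_weight {H V W : Type*} [LieRing H] [LieAlgebra ℂ H]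
    [LieRing.IsNilpotent H] [AddCommGroup V] [Module ℂ V] [LieRingModule H V] [LieModule ℂ H V]
    [FiniteDimensional ℂ V] [AddCommGroup W] [Module ℂ W] [LieRingModule H W] [LieModule ℂ H W]
    (f : V →ₗ⁅ℂ,H⁆ W) (hf : f ≠ 0) :
    ∃ η : Module.Dual ℂ H, (∃ v : V, v ≠ 0 ∧ ∀ x : H, ⁅x, v⁆ = η x • v) ∧
      ∃ w : W, w ≠ 0 ∧ ∀ x : H, ⁅x, w⁆ = η x • w := by
  obtain ⟨χ, hχ⟩ : ∃ χ : Weight ℂ H V, ¬ (genWeightSpace V χ ≤ f.ker) := by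
    by_contra! hc
    have htop : (⊤ : LieSubmodule ℂ H V) ≤ f.ker := by
      rw [← iSup_genWeightSpace_eq_top' ℂ H V]
      exact iSup_le hc
    refine hf (LieModuleHom.ext fun v => ?_)
    simpa using htop (LieSubmodule.mem_top v)
  have : FiniteDimensional ℂ f.range :=
    inferInstanceAs (FiniteDimensional ℂ (LinearMap.range (f : V →ₗ[ℂ] W)))
  -- The generalized weight space of `χ` in `f.range` contains the image of the one in `V`.
  have hχ' : genWeightSpace f.range (χ : H → ℂ) ≠ ⊥ := by
    intro hbot
    obtain ⟨v, hv, hfv⟩ := SetLike.not_le_iff_exists.mp hχ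
    refine hfv ?_
    have hmem : (⟨f v, (f.mem_range _).mpr ⟨v, rfl⟩⟩ : f.range) ∈
        genWeightSpace f.range (χ : H → ℂ) := by
      rw [← comap_genWeightSpace_eq_of_injective (f := f.range.incl)
        f.range.injective_incl, LieSubmodule.mem_comap]
      exact map_genWeightSpace_le f (LieSubmodule.mem_map_of_mem hv)
    rw [hbot, LieSubmodule.mem_bot] at hmem
    simpa using congrArg Subtype.val hmem
  obtain ⟨v, hv, hv'⟩ := exists_forall_lie_eq_smul ℂ H V χ
  obtain ⟨w, hw, hw'⟩ := exists_forall_lie_eq_smul ℂ H f.range ⟨χ, hχ'⟩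
  exact ⟨χ.toLinear, ⟨v, hv, hv'⟩, w, by simpa using hw,
    fun x => by simpa using congrArg Subtype.val (hw' x)⟩

/-- If a subalgebra `p ⊇ h` acts locally finitely on `M`, with `h` nilpotent, then every nonzero
subquotient of `M` contains a weight vector for `h` whose weight belongs to the support of `M`. -/
theorem LieModule.IsSubquotient.exists_weight_vector {g M M₁ : Type*}
    [LieRing g] [LieAlgebra ℂ g] {h p : LieSubalgebra ℂ g} [LieRing.IsNilpotent h] (hhp : h ≤ p)
    [AddCommGroup M] [Module ℂ M] [LieRingModule g M] [LieModule ℂ g M]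
    [AddCommGroup M₁] [Module ℂ M₁] [LieRingModule g M₁] [LieModule ℂ g M₁]
    (hM : LieModule.ActsLocallyFinitely p M)
    (hM₁ : LieModule.IsSubquotient g M₁ M) [Nontrivial M₁] :
    ∃ η ∈ LieModule.support h M, ∃ w : M₁, w ≠ 0 ∧ ∀ x : h, ⁅x, w⁆ = η x • w := by
  obtain ⟨N, f, hf⟩ := hM₁
  obtain ⟨m, hm⟩ := exists_ne (0 : M₁)
  obtain ⟨n, rfl⟩ := hf m
  let f' : N →ₗ⁅ℂ,h⁆ M₁ := { (f : N →ₗ[ℂ] M₁) with map_lie' := fun {x y} => f.map_lie (x : g) y }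
  let V : LieSubmodule ℂ h N := LieSubmodule.lieSpan ℂ h {n}
  have hnV : n ∈ V := LieSubmodule.subset_lieSpan rfl
  -- `V` embeds in the `p`-submodule of `M` generated by `n`, which is finite-dimensional.
  let W : LieSubmodule ℂ p M := LieSubmodule.lieSpan ℂ p {(n : M)}
  have : FiniteDimensional ℂ W := hM n
  let W' : LieSubmodule ℂ h N :=
    { (W : Submodule ℂ M).comap (N : Submodule ℂ M).subtype with
      lie_mem := fun {x y} hy => W.lie_mem (x := ⟨(x : g), hhp x.2⟩) hy }
  have hVW : V ≤ W' := by
    refine LieSubmodule.lieSpan_le.mpr ?_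
    rintro _ rfl
    exact LieSubmodule.subset_lieSpan (R := ℂ) (L := p) rfl
  have : FiniteDimensional ℂ V := by
    let i : V →ₗ[ℂ] W := LinearMap.codRestrict (W : Submodule ℂ M)
      ((N : Submodule ℂ M).subtype ∘ₗ (V : Submodule ℂ N).subtype) (fun v => hVW v.2)
    refine FiniteDimensional.of_injective i fun a b hab => ?_
    exact Subtype.ext (Subtype.ext (congrArg (fun w : W => (w : M)) hab))
  obtain ⟨η, ⟨v, hv, hv'⟩, hw⟩ := (f'.comp V.incl).exists_common_weight
    (fun h0 => hm (LieModuleHom.congr_fun h0 ⟨n, hnV⟩))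
  refine ⟨η, fun hbot => hv ?_, hw⟩
  have hmem : ((v : N) : M) ∈ weightSpace M (η : h → ℂ) := by
    rw [mem_weightSpace]
    intro x
    exact congrArg (fun u : V => ((u : N) : M)) (hv' x)
  rw [hbot, LieSubmodule.mem_bot] at hmem
  exact Subtype.ext (Subtype.ext hmem)

/-! ### Locally finite actions of an `sl₂`-triple -/

/-- If `T` acts on all the vectors `(x ^ k) v` with distinct eigenvalues, and these vectors span a
finite-dimensional space, then one of them vanishes. -/
theorem Module.End.exists_pow_apply_eq_zero {N : Type*} [AddCommGroup N] [Module ℂ N]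
    (T x : Module.End ℂ N) (v : N)
    (hfin : FiniteDimensional ℂ (Submodule.span ℂ (Set.range fun k : ℕ => (x ^ k) v)))
    (μ : ℕ → ℂ) (hμ : Function.Injective μ) (hT : ∀ k, T ((x ^ k) v) = μ k • (x ^ k) v) :
    ∃ k, (x ^ k) v = 0 := by
  by_contra! hne
  have hli : LinearIndependent ℂ fun k : ℕ => (x ^ k) v :=
    Module.End.eigenvectors_linearIndependent' T μ hμ _
      fun k => ⟨Module.End.mem_eigenspace_iff.mpr (hT k), hne k⟩
  have := (linearIndependent_span hli).finite
  exact not_finite ℕ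

/-- Finite-dimensionality of the module is replaced here by local finiteness of `e` and `f`
separately, so no finite-dimensional `sl₂`-submodule containing `v` is needed. -/
theorem IsSl2Triple.exists_int_of_locallyFinite {g N : Type*} [LieRing g] [LieAlgebra ℂ g]
    [AddCommGroup N] [Module ℂ N] [LieRingModule g N] [LieModule ℂ g N] {t e f : g}
    (hs : IsSl2Triple t e f) (he : e ∈ LieModule.fernandoKac g N)
    (hf : f ∈ LieModule.fernandoKac g N) {v : N} (hv : v ≠ 0) {c : ℂ} (hc : ⁅t, v⁆ = c • v) :
    ∃ n : ℤ, c = n := by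
  obtain ⟨k, hk, hk'⟩ := Nat.exists_not_and_succ_of_not_zero_of_exists
    (p := fun k => (toEnd ℂ g N e ^ k) v = 0) (by simpa using hv)
    (Module.End.exists_pow_apply_eq_zero (toEnd ℂ g N t) _ v (he v) (fun k => c + 2 * k)
      (fun a b hab => by simpa using hab) (fun k => hs.lie_h_pow_toEnd_e hc k))
  have P : hs.HasPrimitiveVectorWith ((toEnd ℂ g N e ^ k) v) (c + 2 * k) :=
    { ne_zero := hk
      lie_h := hs.lie_h_pow_toEnd_e hc k
      lie_e := by rwa [lie_e_pow_toEnd_e k] }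
  obtain ⟨n, hn, hn'⟩ := Nat.exists_not_and_succ_of_not_zero_of_exists
    (p := fun n => (toEnd ℂ g N f ^ n) ((toEnd ℂ g N e ^ k) v) = 0) hk
    (Module.End.exists_pow_apply_eq_zero (toEnd ℂ g N t) _ _ (hf _)
      (fun n => c + 2 * k - 2 * n) (fun a b hab => by simpa using hab)
      (fun n => P.lie_h_pow_toEnd_f n))
  -- As `e fⁿ⁺¹ w = (n + 1) (c + 2k - n) fⁿ w` for the primitive vector `w = eᵏ v`, the eigenvalue
  -- `c + 2k` of `w` is `n`.
  have h0 := P.lie_e_pow_succ_toEnd_f n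
  rw [hn', lie_zero, eq_comm, smul_eq_zero, or_iff_left hn, mul_eq_zero,
    or_iff_right (by exact_mod_cast n.succ_ne_zero)] at h0
  refine ⟨n - 2 * k, ?_⟩
  push_cast
  linear_combination h0

/-! ### Coroots of a subalgebra and `sl₂`-triples -/

section Coroot

variable {g : Type*} [LieRing g] [LieAlgebra ℂ g] [FiniteDimensional ℂ g]
  [LieAlgebra.IsKilling ℂ g] (l h : LieSubalgebra ℂ g) [h.IsCartanSubalgebra]
  [(h.within l).IsCartanSubalgebra]

/-- Since `h` acts semisimply on `g`, the generalized root spaces of `h ∩ l` in `l` are genuine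
root spaces. -/
theorem LieSubalgebra.lie_eq_smul_of_mem_rootSpace_within {α : h.within l → ℂ} {x : l}
    (hx : x ∈ rootSpace (h.within l) α) (t : h.within l) :
    ⁅((t : l) : g), (x : g)⁆ = α t • (x : g) := by
  obtain ⟨k, hk⟩ := (mem_genWeightSpace _ _ _).mp hx t
  have hcomm : ∀ k : ℕ, ((((toEnd ℂ (h.within l) l t - α t • (1 : Module.End ℂ l)) ^ k) x : l) : g)
      = ((ad ℂ g ((t : l) : g) - α t • (1 : Module.End ℂ g)) ^ k) (x : g) := by
    intro k
    induction k with
    | zero => simp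
    | succ k ih =>
      rw [pow_succ', pow_succ', Module.End.mul_apply, Module.End.mul_apply, ← ih]
      simp
  have hmem : (x : g) ∈ (ad ℂ g ((t : l) : g)).maxGenEigenspace (α t) := by
    rw [Module.End.mem_maxGenEigenspace]
    exact ⟨k, by rw [← hcomm, hk]; rfl⟩
  have ht : ((t : l) : g) ∈ h := t.2
  rw [(IsKilling.isSemisimple_ad_of_mem_isCartanSubalgebra
    ht).isFinitelySemisimple.maxGenEigenspace_eq_eigenspace, Module.End.mem_eigenspace_iff] at hmem
  simpa using hmem

/-- This determines the coroot of `α` within `corootSpace α`, without knowing that the root spaces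
of `l` are one-dimensional. -/
theorem LieSubalgebra.eq_zero_of_mem_corootSpace_within {α : h.within l → ℂ} (hα : α ≠ 0)
    {s : h.within l} (hs : s ∈ corootSpace α) (hαs : α s = 0) : s = 0 := by
  have hsh : ((s : l) : g) ∈ h := s.2
  -- The restriction of a root `β` of `g` to `h ∩ l` is a weight of the `l`-module `g`, so
  -- `a α + b β` vanishes at `s` for some integers `a` and `b > 0`.
  have hmem : (⟨((s : l) : g), hsh⟩ : h) ∈ (⨅ β : Weight ℂ h g, β.ker : Submodule ℂ h) := by
    rw [Submodule.mem_iInf]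
    intro β
    obtain ⟨y, hy, hy'⟩ := exists_forall_lie_eq_smul ℂ h g β
    let χ : h.within l → ℂ := fun x => β ⟨((x : l) : g), x.2⟩
    have hχ : genWeightSpace g χ ≠ ⊥ := by
      intro hbot
      have hyχ : y ∈ weightSpace g χ :=
        (mem_weightSpace _ _).mpr fun x => hy' ⟨((x : l) : g), x.2⟩
      exact hy (by simpa [hbot] using weightSpace_le_genWeightSpace g χ hyχ)
    obtain ⟨a, b, hb, hab⟩ := exists_forall_mem_corootSpace_smul_add_eq_zero g α χ hα hχ
    have h0 := hab s hs
    simpa [hαs, hb.ne', χ] using h0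
  rw [IsKilling.iInf_ker_weight_eq_bot, Submodule.mem_bot] at hmem
  exact Subtype.ext (Subtype.ext (congrArg (fun x : h => (x : g)) hmem))

theorem LieSubalgebra.exists_isSl2Triple_of_isCoroot {α : Weight ℂ (h.within l) l}
    {t : h.within l} (ht : LieAlgebra.IsCoroot (h.within l) α t) :
    ∃ e f : l, IsSl2Triple ((t : l) : g) (e : g) (f : g) := by
  obtain ⟨hα, htα, ht2⟩ := ht
  have hα0 : (α : h.within l → ℂ) ≠ 0 := hα
  let φ : Module.Dual ℂ (h.within l) := Weight.toLinear ℂ (h.within l) l α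
  -- Some bracket of root vectors is not killed by `α`, as `α t ≠ 0`.
  obtain ⟨u, ⟨e, he, f, hf, huef⟩, hu⟩ : ∃ u : h.within l,
      (∃ y ∈ rootSpace (h.within l) α, ∃ z ∈ rootSpace (h.within l) (-α), ⁅y, z⁆ = (u : l)) ∧
        α u ≠ 0 := by
    by_contra! hc
    have hle : t ∈ LinearMap.ker φ :=
      Submodule.span_le.mpr (fun u hu => hc u hu) (mem_corootSpace' _ |>.mp htα)
    have : α t = 0 := hle
    simp [this] at ht2
  -- After rescaling, the bracket takes the value `2` under `α`, so it coincides with `t`.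
  have huα : u ∈ corootSpace (α : h.within l → ℂ) :=
    (mem_corootSpace' _).mpr (Submodule.subset_span ⟨e, he, f, hf, huef⟩)
  have htu : t = (2 / α u) • u := by
    refine sub_eq_zero.mp (eq_zero_of_mem_corootSpace_within l h hα0
      (sub_mem htα (Submodule.smul_mem (corootSpace (α : h.within l → ℂ)).toSubmodule _ huα)) ?_)
    have : φ (t - (2 / α u) • u) = α t - 2 / α u * α u := by simp [φ]
    rw [ht2, div_mul_cancel₀ _ hu, sub_self] at this
    exact this
  have he' := lie_eq_smul_of_mem_rootSpace_within l h he t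
  have hf' := lie_eq_smul_of_mem_rootSpace_within l h hf t
  rw [Pi.neg_apply] at hf'
  rw [ht2] at he' hf'
  refine ⟨(2 / α u) • e, f, ?_, ?_, ?_, ?_⟩
  · intro h0
    have : t = 0 := Subtype.ext (Subtype.ext h0)
    have h1 : φ t = 2 := ht2
    simp [this] at h1
  · have hval : ((⁅e, f⁆ : l) : g) = ((u : l) : g) := congrArg Subtype.val huef
    rw [htu]
    simpa using congrArg ((2 / α u) • ·) hval
  · change ⁅((t : l) : g), (2 / α u) • (e : g)⁆ = 2 • ((2 / α u) • (e : g))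
    rw [lie_smul, he']
    rw [smul_comm, ofNat_smul_eq_nsmul]
  · rw [hf', neg_smul, ofNat_smul_eq_nsmul]

end Coroot

/-! ### Non-integral weights -/

theorem mainTheorem9 {g : Type*} [LieRing g] [LieAlgebra ℂ g] [FiniteDimensional ℂ g]
    [LieAlgebra.IsSemisimple ℂ g]
    (l : LieSubalgebra ℂ g) [LieAlgebra.HasCentralRadical ℂ l]
    (h : LieSubalgebra ℂ g) [h.IsCartanSubalgebra] [(h.within l).IsCartanSubalgebra]
    (p : LieSubalgebra ℂ g) (hp : p.IsParabolic) (hhp : h ≤ p)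
    (hpl : (p.within l).IsParabolic)
    {M : Type*} [AddCommGroup M] [Module ℂ M] [LieRingModule g M] [LieModule ℂ g M]
    (hM : LieModule.ActsLocallyFinitely p M)
    (hη : ∀ η ∈ LieModule.support h M,
      ¬ LieAlgebra.IsIntegralWeight (h.within l) (h.restrictDual l η))
    {M₁ : Type*} [AddCommGroup M₁] [Module ℂ M₁] [LieRingModule g M₁] [LieModule ℂ g M₁]
    (hM₁ : LieModule.IsSubquotient g M₁ M) [Nontrivial M₁] :
    ¬ ((l : Set g) ⊆ LieModule.fernandoKac g M₁) := by
  intro hl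
  obtain ⟨η, hηM, w, hw, hw'⟩ := hM₁.exists_weight_vector hhp hM
  refine hη η hηM fun α t ht => ?_
  obtain ⟨e, f, hs⟩ := LieSubalgebra.exists_isSl2Triple_of_isCoroot l h ht
  exact hs.exists_int_of_locallyFinite (hl e.2) (hl f.2) hw (hw' ⟨((t : l) : g), t.2⟩)
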